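/- Let $m\in\mathbb{N}$ and let $L,M,N\subseteq[m]=\{1,\dots,m\}$. For $X\subseteq[m]$ put $\Delta_X=\{v\in\mathbb{F}_2^m:\mathrm{Supp}(v)\subseteq X\}$ and $\Delta_X^c=\mathbb{F}_2^m\setminus\Delta_X$. Let $\mathcal{R}_2=\mathbb{F}_2[x]/\langle x^3-x\rangle$, $u=x+\langle x^3-x\rangle$, $e_1=1+u^2$, $e_2=u^2$, $e_3=u+u^2$, and for $D_1,D_2,D_3\subseteq\mathbb{F}_2^m$ let $e_1D_1+e_2D_2+e_3D_3=\{e_1d_1+e_2d_2+e_3d_3: d_i\in D_i\}\subseteq\mathcal{R}_2^m$. For a set $D\subseteq\mathcal{R}_2^m$, listed in some order as $d_1,\dots,d_n$ without repetition, let $\mathcal{C}_D=\{(x\cdot d_1,\dots,x\cdot d_n):x\in\mathcal{R}_2^m\}$, and let $\mathcal{C}_D^{(2)}\subseteq\mathbb{F}_2^n$ be its binary subfield code, i.e. the $\mathbb{F}_2$-linear code generated by the matrix obtained from a generator matrix of $\mathcal{C}_D$ over $\mathcal{R}_2$ by replacing each entry by the column of its coordinates relative to an $\mathbb{F}_2$-basis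 of $\mathcal{R}_2$. (The statements below hold for every choice of ordering, generator matrix and basis.) A linear code over a field is minimal if, for all nonzero codewords $c,c'$ with $\mathrm{Supp}(c')\subseteq\mathrm{Supp}(c)$, $c'$ is a nonzero scalar multiple of $c$. It is (Euclidean) self-orthogonal if $c\cdot c'=0$ for all codewords $c,c'$. **Theorem.** For each of the following sets $D$, the code $\mathcal{C}_D^{(2)}$ is minimal if the condition (min) holds, and it is self-orthogonal if the condition (so) holds. Here $m-2$ and $3m-2$ are integers, possibly negative. 1. $D=e_1\Delta_L+e_2\Delta_M+e_3\Delta_N$: (min) no condition, the code is always minimal; (so) $|L|+|M|+|N|\ge3$. 2. $D=e_1\Delta_L^c+e_2\Delta_M+e_3\Delta_N$: (min) $|L|\le m-2$; (so) $|M|+|N|\ge3$. 3. $D=e_1\Delta_L+e_2\Delta_M^c+e_3\Delta_N$: (min) $|M|\le m-2$; (so) $|L|+|N|\ge3$. 4. $D=e_1\Delta_L+e_2\Delta_M+e_3\Delta_N^c$: (min) $|N|\le m-2$; (so) $|L|+|M|\ge3$. 5. $D=e_1\Delta_L^c+e_2\Delta_M^c+e_3\Delta_N$: (min) $\max\{|L|,|M|\}\le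 m-2$; (so) $|N|\ge3$. 6. $D=e_1\Delta_L^c+e_2\Delta_M+e_3\Delta_N^c$: (min) $\max\{|L|,|N|\}\le m-2$; (so) $|M|\ge3$. 7. $D=e_1\Delta_L+e_2\Delta_M^c+e_3\Delta_N^c$: (min) $\max\{|M|,|N|\}\le m-2$; (so) $|L|\ge3$. 8. $D=e_1\Delta_L^c+e_2\Delta_M^c+e_3\Delta_N^c$: (min) $\max\{|L|,|M|,|N|\}\le m-2$; (so) $L,M,N\ne\emptyset$. 9. $D=\mathcal{R}_2^m\setminus(e_1\Delta_L+e_2\Delta_M+e_3\Delta_N)$: (min) $|L|+|M|+|N|\le 3m-2$; (so) $|L|+|M|+|N|\ge3$. -/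

import Mathlib

open Polynomial

/-- The support of a vector. -/
def Supp {F ι : Type*} [Zero F] (v : ι → F) : Set ι := {i | v i ≠ 0}

/-- A linear code is minimal if every nonzero codeword `u` is minimal: every nonzero codeword
whose support is contained in that of `u` is a nonzero scalar multiple of `u`. -/
def IsMinimalCode {F : Type*} [Field F] {n : ℕ} (C : Submodule F (Fin n → F)) : Prop :=
  ∀ u ∈ C, u ≠ 0 → ∀ v ∈ C, v ≠ 0 → Supp v ⊆ Supp u → ∃ a : F, a ≠ 0 ∧ v = a • u

/-- A linear code is (Euclidean) self-orthogonal if any two codewords (possibly equal) are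
orthogonal for the standard bilinear form, i.e. the code is contained in its dual. -/
def IsSelfOrthogonalCode {F : Type*} [Field F] {n : ℕ} (C : Submodule F (Fin n → F)) : Prop :=
  ∀ u ∈ C, ∀ v ∈ C, u ⬝ᵥ v = 0

/-- The linear code `{(x · d₁, …, x · dₙ) : x ∈ R ^ m}` over a commutative ring `R`
with the ordered defining set `d₁, …, dₙ` in `R ^ m`. -/
def definingSetCode {R : Type*} [CommRing R] {m n : ℕ} (d : Fin n → Fin m → R) :
    Submodule R (Fin n → R) where
  carrier := {c | ∃ x : Fin m → R, c = fun j => x ⬝ᵥ d j}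
  add_mem' := by
    rintro _ _ ⟨x, rfl⟩ ⟨y, rfl⟩
    exact ⟨x + y, by funext j; simp [add_dotProduct]⟩
  zero_mem' := ⟨0, by funext j; simp⟩
  smul_mem' := by
    rintro a _ ⟨x, rfl⟩
    exact ⟨a • x, by funext j; simp [smul_dotProduct]⟩

/-- `d` lists the elements of the set `D`, each exactly once. -/
def IsOrdering {V : Type*} {n : ℕ} (D : Set V) (d : Fin n → V) : Prop :=
  Function.Injective d ∧ Set.range d = D

/-- The code over `F` generated by the matrix obtained from `G` by replacing every entry by the
column of its coordinates relative to the basis `b`. -/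
def expandedCode {F R : Type*} [Field F] [CommRing R] [Algebra F R] {r k n : ℕ}
    (b : Module.Basis (Fin r) F R) (G : Matrix (Fin k) (Fin n) R) : Submodule F (Fin n → F) :=
  Submodule.span F (Set.range fun p : Fin k × Fin r => fun j => b.repr (G p.1 j) p.2)

/-- `C'` is the subfield code of the linear code `C` over `R`: for some matrix whose rows generate
`C` and some basis of `R` over `F`, it is the expanded code
(it does not depend on the matrix and the basis). -/
def IsSubfieldCode {F R : Type*} [Field F] [CommRing R] [Algebra F R] {n : ℕ}
    (C : Submodule R (Fin n → R)) (C' : Submodule F (Fin n → F)) : Prop :=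
  ∃ (r k : ℕ) (b : Module.Basis (Fin r) F R) (G : Matrix (Fin k) (Fin n) R),
    Submodule.span R (Set.range fun i => G i) = C ∧ C' = expandedCode b G

/-- The ring `𝔽₂[x] / ⟨x³ - x⟩`. -/
abbrev R2 : Type := AdjoinRoot (X ^ 3 - X : (ZMod 2)[X])

namespace R2

/-- The class of `x`. -/
noncomputable def u : R2 := AdjoinRoot.root (X ^ 3 - X : (ZMod 2)[X])

noncomputable def e₁ : R2 := 1 + u ^ 2

noncomputable def e₂ : R2 := u ^ 2

noncomputable def e₃ : R2 := u + u ^ 2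

end R2

/-- The simplicial complex of `𝔽₂ ^ m` generated by `L`. -/
def simplicialComplex {m : ℕ} (L : Finset (Fin m)) : Set (Fin m → ZMod 2) :=
  {v | Supp v ⊆ (L : Set (Fin m))}

/-- The set `e₁ D₁ + e₂ D₂ + e₃ D₃` in `R2 ^ m`. -/
def definingSet {m : ℕ} (D₁ D₂ D₃ : Set (Fin m → ZMod 2)) : Set (Fin m → R2) :=
  {w | ∃ d₁ ∈ D₁, ∃ d₂ ∈ D₂, ∃ d₃ ∈ D₃,
    w = fun i => d₁ i • R2.e₁ + d₂ i • R2.e₂ + d₃ i • R2.e₃}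

/-- `C` is the binary subfield code of the code over `R2` with defining set `D`,
for some ordering of the elements of `D`. -/
def IsBinarySubfieldCodeOf {m n : ℕ} (D : Set (Fin m → R2))
    (C : Submodule (ZMod 2) (Fin n → ZMod 2)) : Prop :=
  ∃ d : Fin n → Fin m → R2, IsOrdering D d ∧ IsSubfieldCode (definingSetCode d) C

/-!
The binary subfield code of a code with defining set `D ⊆ R2 ^ m` consists of evaluations of
`𝔽₂`-linear functionals at the points of `D` (`IsSubfieldCode.exists_eval`). As `e₁, e₂, e₃` is an
`𝔽₂`-basis of `R2`, the space `R2 ^ m` is identified with `(𝔽₂ ^ m) ^ 3` (`R2.combinationPi`), and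
`D` becomes a product of coordinate subspaces and complements of coordinate subspaces, or the
complement of such a product. Both claims are then about pairs of functionals on such a set `S`.

*Minimality.* Two functionals form a linear map `f` to the plane `𝔽₂²`, and containment of supports
says that `(1, 0) ∉ f(S)`. If `f(S)` is a subspace or equals `𝔽₂² \ {0}`, this makes the first
functional zero on `S` or equal to the second on `S` (`IsPlanarFull.eq_of_support_subset`). Images
are of this form for subspaces, for complements of subspaces of codimension at least two
(`IsPlanarFull.compl_submodule`), and for products of such sets (`IsPlanarFull.prod`).

*Self-orthogonality.* The sum of `f x * g x` over a subspace of dimension at least three vanishes,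
because translation by a nonzero vector in both kernels pairs off equal terms
(`IsSelfOrthogonalSet.submodule`). Sets with complements are differences of such subspaces.
-/

open scoped Pointwise

/-! ### Sets with large images in the plane -/

/-- A subset `S` of a binary vector space is *planar full* if its image under every linear map to
the plane `𝔽₂²` is either a linear subspace or the set of all nonzero vectors. -/
def IsPlanarFull {E : Type*} [AddCommGroup E] [Module (ZMod 2) E] (S : Set E) : Prop :=
  ∀ f : E →ₗ[ZMod 2] ZMod 2 × ZMod 2,
    f '' S = {0}ᶜ ∨ ∃ W : Submodule (ZMod 2) (ZMod 2 × ZMod 2), f '' S = W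

lemma IsPlanarFull.submodule {E : Type*} [AddCommGroup E] [Module (ZMod 2) E]
    (U : Submodule (ZMod 2) E) : IsPlanarFull (U : Set E) :=
  fun f => .inr ⟨U.map f, rfl⟩

/-- A fibre of `f` over a point of its range has as many elements as the kernel, hence at least
`|E| / 4`. So a fibre avoiding `Uᶜ` forces `f` to be surjective and the fibre to be all of `U`;
as `0 ∈ U`, this can only be the fibre over `0`. -/
lemma IsPlanarFull.compl_submodule {E : Type*} [AddCommGroup E] [Module (ZMod 2) E] [Finite E]
    (U : Submodule (ZMod 2) E) (hU : 4 * Nat.card U ≤ Nat.card E) :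
    IsPlanarFull ((U : Set E)ᶜ) := by
  intro f
  have key : ∀ x : E, f x ∉ f '' (U : Set E)ᶜ → f x = 0 ∧ LinearMap.range f = ⊤ := by
    intro x hx
    have hfib : (fun y : E => x + y) '' (LinearMap.ker f : Set E) ⊆ U := by
      rintro _ ⟨y, hy, rfl⟩
      by_contra hxy
      exact hx ⟨x + y, hxy, by rw [map_add, LinearMap.mem_ker.1 hy, add_zero]⟩
    have hcard : ((fun y : E => x + y) '' (LinearMap.ker f : Set E)).ncard =
        Nat.card (LinearMap.ker f) :=
      (Set.ncard_image_of_injective _ (add_right_injective x)).trans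
        (Nat.card_coe_set_eq _).symm
    have hle : Nat.card (LinearMap.ker f) ≤ Nat.card U := by
      rw [← hcard]
      exact (Set.ncard_le_ncard hfib (Set.toFinite _)).trans (Nat.card_coe_set_eq _).ge
    have hmul : Nat.card E = Nat.card (LinearMap.ker f) * Nat.card (LinearMap.range f) := by
      rw [Submodule.card_eq_card_quotient_mul_card (LinearMap.ker f),
        Nat.card_congr f.quotKerEquivRange.toEquiv, mul_comm]
    have h4 : Nat.card (ZMod 2 × ZMod 2) = 4 := by simp
    have hr : Nat.card (LinearMap.range f) ≤ 4 := by
      rw [← h4]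
      exact Nat.card_le_card_of_injective _ Subtype.val_injective
    have hpos : 0 < Nat.card U := Nat.card_pos
    have hr4 : Nat.card (LinearMap.range f) = 4 := by
      by_contra hne
      have : Nat.card (LinearMap.range f) ≤ 3 := by omega
      nlinarith
    have hUk : Nat.card U ≤ Nat.card (LinearMap.ker f) := by
      rw [hr4] at hmul
      omega
    have heq : (fun y : E => x + y) '' (LinearMap.ker f : Set E) = U :=
      Set.eq_of_subset_of_ncard_le hfib
        (by rw [hcard]; exact (Nat.card_coe_set_eq _).ge.trans hUk) (Set.toFinite _)
    constructor
    · obtain ⟨y, hy, hxy⟩ : (0 : E) ∈ (fun y : E => x + y) '' (LinearMap.ker f : Set E) := by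
        rw [heq]
        exact U.zero_mem
      have := congrArg f hxy
      simpa [LinearMap.mem_ker.1 hy] using this
    · apply SetLike.coe_injective
      apply Set.eq_of_subset_of_ncard_le (Set.subset_univ _) _ (Set.toFinite _)
      rw [Set.ncard_univ, h4, ← hr4]
      exact (Nat.card_coe_set_eq _).le
  by_cases h0 : 0 ∈ f '' (U : Set E)ᶜ
  · refine .inr ⟨LinearMap.range f, Set.Subset.antisymm ?_ ?_⟩
    · rintro _ ⟨x, -, rfl⟩
      exact ⟨x, rfl⟩
    · rintro _ ⟨x, rfl⟩
      by_contra hx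
      exact hx ((key x hx).1 ▸ h0)
  · have htop : LinearMap.range f = ⊤ := (key 0 (by rwa [map_zero])).2
    refine .inl (Set.Subset.antisymm ?_ ?_)
    · rintro p hp rfl
      exact h0 hp
    · intro p hp
      obtain ⟨x, rfl⟩ := LinearMap.range_eq_top.1 htop p
      by_contra hx
      exact hp (key x hx).1

/-- The sum of `{0}ᶜ` with a subspace or with itself is `{0}ᶜ` or the whole plane. -/
lemma IsPlanarFull.prod {E F : Type*} [AddCommGroup E] [Module (ZMod 2) E] [AddCommGroup F]
    [Module (ZMod 2) F] {S : Set E} {T : Set F} (hS : IsPlanarFull S) (hT : IsPlanarFull T) :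
    IsPlanarFull (S ×ˢ T) := by
  intro f
  have himg : f '' (S ×ˢ T) =
      (f ∘ₗ LinearMap.inl (ZMod 2) E F) '' S + (f ∘ₗ LinearMap.inr (ZMod 2) E F) '' T := by
    ext p
    constructor
    · rintro ⟨⟨x, y⟩, ⟨hx, hy⟩, rfl⟩
      refine Set.mem_add.2 ⟨_, ⟨x, hx, rfl⟩, _, ⟨y, hy, rfl⟩, ?_⟩
      simp [← map_add]
    · intro hp
      obtain ⟨_, ⟨x, hx, rfl⟩, _, ⟨y, hy, rfl⟩, rfl⟩ := Set.mem_add.1 hp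
      exact ⟨(x, y), ⟨hx, hy⟩, by simp [← map_add]⟩
  -- In characteristic two `0 = q + q`, so one nonzero `q ∈ W` already puts `0` into the sum.
  have hchar : ∀ p : ZMod 2 × ZMod 2, p + p = 0 := by decide
  have hsub : ∀ W : Submodule (ZMod 2) (ZMod 2 × ZMod 2),
      ({0}ᶜ + (W : Set (ZMod 2 × ZMod 2)) = {0}ᶜ) ∨
      ({0}ᶜ + (W : Set (ZMod 2 × ZMod 2)) = (⊤ : Submodule (ZMod 2) (ZMod 2 × ZMod 2))) := by
    intro W
    by_cases hW : W = ⊥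
    · left
      simp [hW]
    · right
      obtain ⟨q, hq, hq0⟩ := W.ne_bot_iff.1 hW
      refine Set.eq_univ_of_forall fun p => Set.mem_add.2 ?_
      by_cases hp : p = 0
      · exact ⟨q, hq0, q, hq, by rw [hp, hchar]⟩
      · exact ⟨p, hp, 0, W.zero_mem, add_zero p⟩
  have hself : ({0}ᶜ + {0}ᶜ : Set (ZMod 2 × ZMod 2)) =
      (⊤ : Submodule (ZMod 2) (ZMod 2 × ZMod 2)) := by
    have : ∀ p : ZMod 2 × ZMod 2, ∃ a, a ≠ 0 ∧ ∃ b, b ≠ 0 ∧ a + b = p := by decide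
    exact Set.eq_univ_of_forall fun p => Set.mem_add.2 (this p)
  rw [himg]
  rcases hS (f ∘ₗ LinearMap.inl (ZMod 2) E F) with h₁ | ⟨W₁, h₁⟩ <;>
  rcases hT (f ∘ₗ LinearMap.inr (ZMod 2) E F) with h₂ | ⟨W₂, h₂⟩ <;> rw [h₁, h₂]
  · exact .inr ⟨⊤, hself⟩
  · exact (hsub W₂).imp_right fun h => ⟨⊤, h⟩
  · rw [add_comm]
    exact (hsub W₁).imp_right fun h => ⟨⊤, h⟩
  · exact .inr ⟨W₁ ⊔ W₂, (Submodule.coe_sup W₁ W₂).symm⟩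

/-- On a planar full set, a linear functional that does not vanish identically agrees with every
linear functional whose support contains its own. -/
lemma IsPlanarFull.eq_of_support_subset {E : Type*} [AddCommGroup E] [Module (ZMod 2) E]
    {S : Set E} (hS : IsPlanarFull S) (f g : E →ₗ[ZMod 2] ZMod 2)
    (hf : ∃ x ∈ S, f x ≠ 0) (hfg : ∀ x ∈ S, f x ≠ 0 → g x ≠ 0) : ∀ x ∈ S, f x = g x := by
  have hone : ∀ a : ZMod 2, a ≠ 0 → a = 1 := by decide
  have hnot : ((1, 0) : ZMod 2 × ZMod 2) ∉ f.prod g '' S := by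
    rintro ⟨x, hx, hxp⟩
    obtain ⟨h1, h2⟩ := Prod.mk.inj hxp
    exact hfg x hx (by simp_all) (by simpa using h2)
  obtain ⟨x₀, hx₀, hfx₀⟩ := hf
  have h11 : ((1, 1) : ZMod 2 × ZMod 2) ∈ f.prod g '' S :=
    ⟨x₀, hx₀, Prod.ext (hone _ hfx₀) (hone _ (hfg x₀ hx₀ hfx₀))⟩
  -- If the image is a subspace, it cannot contain `(0, 1)`, as `(1, 1) - (0, 1) = (1, 0)`.
  rcases hS (f.prod g) with h | ⟨W, h⟩
  · rw [h] at hnot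
    exact absurd (by decide) hnot
  · intro x hx
    by_cases hfx : f x = 0
    · by_contra hgx
      have h01 : ((0, 1) : ZMod 2 × ZMod 2) ∈ f.prod g '' S :=
        ⟨x, hx, Prod.ext hfx (hone _ fun h' => hgx (hfx.trans h'.symm))⟩
      rw [h] at h11 h01 hnot
      exact hnot (by simpa using W.sub_mem h11 h01)
    · rw [hone _ hfx, hone _ (hfg x hx hfx)]

/-! ### Sets on which linear functionals are orthogonal -/

open Classical in
/-- Any two linear functionals on a finite binary vector space are orthogonal when evaluated on
the points of `S`. -/
def IsSelfOrthogonalSet {E : Type*} [AddCommGroup E] [Module (ZMod 2) E] [Fintype E]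
    (S : Set E) : Prop :=
  ∀ f g : E →ₗ[ZMod 2] ZMod 2, ∑ x with x ∈ S, f x * g x = 0

/-- A subspace with more than four elements contains a nonzero `w` killed by both functionals, so
translation by `w` pairs off equal terms of the sum. -/
lemma IsSelfOrthogonalSet.submodule {E : Type*} [AddCommGroup E] [Module (ZMod 2) E] [Fintype E]
    (U : Submodule (ZMod 2) E) (hU : 4 < Nat.card U) : IsSelfOrthogonalSet (U : Set E) := by
  classical
  intro f g
  obtain ⟨w, hw, hw0, hfw, hgw⟩ : ∃ w ∈ U, w ≠ 0 ∧ f w = 0 ∧ g w = 0 := by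
    have hni : ¬ Function.Injective fun x : U => (f x, g x) := by
      intro hinj
      have := Nat.card_le_card_of_injective _ hinj
      simp only [Nat.card_prod, Nat.card_zmod] at this
      omega
    obtain ⟨x, y, hxy, hne⟩ : ∃ x y : U, (f x, g x) = (f y, g y) ∧ x ≠ y := by
      simpa only [Function.Injective, not_forall, exists_prop] using hni
    obtain ⟨h1, h2⟩ := Prod.mk.inj hxy
    exact ⟨x - y, U.sub_mem x.2 y.2, fun h => hne (Subtype.ext (sub_eq_zero.1 h)),
      by rw [map_sub, h1, sub_self], by rw [map_sub, h2, sub_self]⟩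
  have hww : w + w = 0 := by
    rw [← two_smul (ZMod 2) w, show (2 : ZMod 2) = 0 from rfl, zero_smul]
  refine Finset.sum_involution (fun x _ => x + w) (fun x _ => ?_) (fun x _ _ h => ?_)
    (fun x hx => ?_) (fun x _ => ?_)
  · rw [map_add, map_add, hfw, hgw, add_zero, add_zero]
    exact CharTwo.add_self_eq_zero _
  · exact hw0 (by simpa using h)
  · simp only [Finset.mem_filter, Finset.mem_univ, true_and] at hx ⊢
    exact U.add_mem hx hw
  · rw [add_assoc, hww, add_zero]

lemma IsSelfOrthogonalSet.diff {E : Type*} [AddCommGroup E] [Module (ZMod 2) E] [Fintype E]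
    {S T : Set E} (hS : IsSelfOrthogonalSet S) (hT : IsSelfOrthogonalSet T) (hTS : T ⊆ S) :
    IsSelfOrthogonalSet (S \ T) := by
  classical
  intro f g
  have h := Finset.sum_sdiff (f := fun x => f x * g x)
    (Finset.monotone_filter_right (Finset.univ : Finset E) (p := (· ∈ T)) (q := (· ∈ S))
      fun x _ hx => hTS hx)
  rw [hS f g, hT f g, add_zero, ← Finset.filter_and_not] at h
  simpa only [Set.mem_sdiff] using h

/-! ### Codewords of the subfield code -/

/-- Every codeword of the subfield code evaluates an `F`-linear functional at the points of the
defining set. -/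
lemma IsSubfieldCode.exists_eval {F R : Type*} [Field F] [CommRing R] [Algebra F R] {m n : ℕ}
    {d : Fin n → Fin m → R} {C : Submodule F (Fin n → F)}
    (hC : IsSubfieldCode (definingSetCode d) C) {c : Fin n → F} (hc : c ∈ C) :
    ∃ f : (Fin m → R) →ₗ[F] F, ∀ j, c j = f (d j) := by
  obtain ⟨r, k, b, G, hG, rfl⟩ := hC
  refine Submodule.span_induction (p := fun c _ => ∃ f : (Fin m → R) →ₗ[F] F, ∀ j, c j = f (d j))
    ?_ ⟨0, fun j => rfl⟩ ?_ ?_ hc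
  · rintro _ ⟨⟨i, s⟩, rfl⟩
    obtain ⟨x, hx⟩ : G i ∈ definingSetCode d := hG ▸ Submodule.subset_span ⟨i, rfl⟩
    exact ⟨b.coord s ∘ₗ ((dotProductBilin R R x).restrictScalars F), fun j => by
      simp [hx]⟩
  · rintro _ _ _ _ ⟨f, hf⟩ ⟨g, hg⟩
    exact ⟨f + g, fun j => by simp [hf, hg]⟩
  · rintro a _ _ ⟨f, hf⟩
    exact ⟨a • f, fun j => by simp [hf]⟩

section Transfer

variable {E : Type*} [AddCommGroup E] [Module (ZMod 2) E] {m n : ℕ} {S : Set E}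
  {C : Submodule (ZMod 2) (Fin n → ZMod 2)} {Φ : E ≃ₗ[ZMod 2] (Fin m → R2)}

lemma IsBinarySubfieldCodeOf.isMinimalCode (hC : IsBinarySubfieldCodeOf (Φ '' S) C)
    (hS : IsPlanarFull S) : IsMinimalCode C := by
  obtain ⟨d, ⟨-, hd⟩, hC⟩ := hC
  intro v hv _ c hc hc0 hsupp
  obtain ⟨f, hf⟩ := hC.exists_eval hc
  obtain ⟨g, hg⟩ := hC.exists_eval hv
  have hpt : ∀ x ∈ S, ∃ j, d j = Φ x := fun x hx => hd.ge ⟨x, hx, rfl⟩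
  have heq := hS.eq_of_support_subset (f ∘ₗ Φ.toLinearMap) (g ∘ₗ Φ.toLinearMap)
    (by
      obtain ⟨j, hj⟩ := Function.ne_iff.1 hc0
      obtain ⟨x, hx, hxj⟩ := hd.le ⟨j, rfl⟩
      exact ⟨x, hx, by simpa [hxj, ← hf] using hj⟩)
    (fun x hx hfx => by
      obtain ⟨j, hj⟩ := hpt x hx
      have : j ∈ Supp v := hsupp (show c j ≠ 0 by simpa [hf, hj] using hfx)
      have : v j ≠ 0 := this
      simpa [hg, hj] using this)
  refine ⟨1, one_ne_zero, ?_⟩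
  rw [one_smul]
  funext j
  obtain ⟨x, hx, hxj⟩ := hd.le ⟨j, rfl⟩
  rw [hf, hg, ← hxj]
  exact heq x hx

lemma IsBinarySubfieldCodeOf.isSelfOrthogonalCode [Fintype E]
    (hC : IsBinarySubfieldCodeOf (Φ '' S) C) (hS : IsSelfOrthogonalSet S) :
    IsSelfOrthogonalCode C := by
  classical
  obtain ⟨d, ⟨hinj, hd⟩, hC⟩ := hC
  intro c hc v hv
  obtain ⟨f, hf⟩ := hC.exists_eval hc
  obtain ⟨g, hg⟩ := hC.exists_eval hv
  rw [← hS (f ∘ₗ Φ.toLinearMap) (g ∘ₗ Φ.toLinearMap)]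
  refine Finset.sum_bij (fun j _ => Φ.symm (d j)) (fun j _ => ?_)
    (fun i _ j _ hij => hinj (Φ.symm.injective hij)) (fun x hx => ?_) (fun j _ => ?_)
  · obtain ⟨x, hx, hxj⟩ := hd.le ⟨j, rfl⟩
    simpa [← hxj] using hx
  · obtain ⟨j, hj⟩ := hd.ge ⟨x, (Finset.mem_filter.1 hx).2, rfl⟩
    exact ⟨j, Finset.mem_univ j, by rw [hj, Φ.symm_apply_apply]⟩
  · simp [hf, hg]

end Transfer

/-! ### Coordinates relative to the elements `e₁`, `e₂`, `e₃` -/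

namespace R2

lemma monic_X_pow_three_sub_X : (X ^ 3 - X : (ZMod 2)[X]).Monic := by
  monicity!

lemma natDegree_X_pow_three_sub_X : (X ^ 3 - X : (ZMod 2)[X]).natDegree = 3 := by
  compute_degree!

/-- The map `(a, b, c) ↦ a e₁ + b e₂ + c e₃`. -/
noncomputable def combination : ZMod 2 × ZMod 2 × ZMod 2 →ₗ[ZMod 2] R2 :=
  (LinearMap.toSpanSingleton (ZMod 2) R2 e₁).coprod
    ((LinearMap.toSpanSingleton (ZMod 2) R2 e₂).coprod
      (LinearMap.toSpanSingleton (ZMod 2) R2 e₃))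

lemma combination_apply (a b c : ZMod 2) :
    combination (a, b, c) = a • e₁ + b • e₂ + c • e₃ := by
  simp [combination, add_assoc]

/-- In the power basis `1, u, u²` the coordinates of `a e₁ + b e₂ + c e₃` are `a`, `c` and
`a + b + c`. -/
lemma combination_injective : Function.Injective combination := by
  rw [injective_iff_map_eq_zero]
  rintro ⟨a, b, c⟩ h
  have hmk : combination (a, b, c) =
      AdjoinRoot.mk (X ^ 3 - X) (C a + C c * X + C (a + b + c) * X ^ 2) := by
    rw [combination_apply]
    simp only [e₁, e₂, e₃, u, Algebra.smul_def, AdjoinRoot.algebraMap_eq, map_add, map_mul,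
      map_pow, AdjoinRoot.mk_C, AdjoinRoot.mk_X]
    ring
  rw [hmk, AdjoinRoot.mk_eq_zero] at h
  have h0 : C a + C c * X + C (a + b + c) * X ^ 2 = 0 := by
    refine eq_zero_of_dvd_of_natDegree_lt h ?_
    rw [natDegree_X_pow_three_sub_X]
    exact lt_of_le_of_lt (b := 2) (by compute_degree) (by norm_num)
  have c0 := congrArg (fun p => coeff p 0) h0
  have c1 := congrArg (fun p => coeff p 1) h0
  have c2 := congrArg (fun p => coeff p 2) h0
  simp only [coeff_add, coeff_C_mul, coeff_X_pow, coeff_X, coeff_C, coeff_zero] at c0 c1 c2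
  norm_num at c0 c1 c2
  subst c0 c1
  simpa using c2

lemma combination_bijective : Function.Bijective combination := by
  have hfin : Module.finrank (ZMod 2) R2 = 3 := by
    rw [(AdjoinRoot.powerBasis' monic_X_pow_three_sub_X).finrank,
      AdjoinRoot.powerBasis'_dim, natDegree_X_pow_three_sub_X]
  have : Module.Finite (ZMod 2) R2 := monic_X_pow_three_sub_X.finite_adjoinRoot
  refine ⟨combination_injective, ?_⟩
  rw [← LinearMap.injective_iff_surjective_of_finrank_eq_finrank (by simp [hfin])]
  exact combination_injective

/-- The isomorphism `(d₁, d₂, d₃) ↦ e₁ d₁ + e₂ d₂ + e₃ d₃`. -/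
noncomputable def combinationPi (m : ℕ) :
    ((Fin m → ZMod 2) × (Fin m → ZMod 2) × (Fin m → ZMod 2)) ≃ₗ[ZMod 2] (Fin m → R2) :=
  LinearEquiv.ofBijective
    (LinearMap.pi fun i => combination ∘ₗ (LinearMap.proj i).prodMap
      ((LinearMap.proj i).prodMap (LinearMap.proj i))) <| by
    constructor
    · intro v w h
      have hi := fun i => combination_injective (congrFun h i)
      refine Prod.ext (funext fun i => ?_) (Prod.ext (funext fun i => ?_) (funext fun i => ?_))
      · exact congrArg Prod.fst (hi i)
      · exact congrArg (fun p => p.2.1) (hi i)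
      · exact congrArg (fun p => p.2.2) (hi i)
    · intro w
      choose p hp using fun i => combination_bijective.2 (w i)
      exact ⟨(fun i => (p i).1, fun i => (p i).2.1, fun i => (p i).2.2), funext hp⟩

lemma combinationPi_apply {m : ℕ} (d₁ d₂ d₃ : Fin m → ZMod 2) :
    combinationPi m (d₁, d₂, d₃) = fun i => d₁ i • e₁ + d₂ i • e₂ + d₃ i • e₃ :=
  funext fun i => combination_apply (d₁ i) (d₂ i) (d₃ i)

end R2

lemma definingSet_eq_image {m : ℕ} (D₁ D₂ D₃ : Set (Fin m → ZMod 2)) :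
    definingSet D₁ D₂ D₃ = R2.combinationPi m '' (D₁ ×ˢ D₂ ×ˢ D₃) := by
  ext w
  constructor
  · rintro ⟨d₁, h₁, d₂, h₂, d₃, h₃, rfl⟩
    exact ⟨(d₁, d₂, d₃), ⟨h₁, h₂, h₃⟩, R2.combinationPi_apply d₁ d₂ d₃⟩
  · rintro ⟨⟨d₁, d₂, d₃⟩, ⟨h₁, h₂, h₃⟩, rfl⟩
    exact ⟨d₁, h₁, d₂, h₂, d₃, h₃, R2.combinationPi_apply d₁ d₂ d₃⟩

/-! ### Simplicial complexes as coordinate subspaces -/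

/-- The simplicial complex generated by `L`, as a linear subspace. -/
def coordinateSubspace {m : ℕ} (L : Finset (Fin m)) : Submodule (ZMod 2) (Fin m → ZMod 2) where
  carrier := simplicialComplex L
  add_mem' := by
    intro v w hv hw i hi
    by_contra hiL
    have h1 : v i = 0 := by_contra fun h => hiL (hv h)
    have h2 : w i = 0 := by_contra fun h => hiL (hw h)
    exact hi (by simp [h1, h2])
  zero_mem' := fun _ hi => absurd rfl hi
  smul_mem' := by
    intro a v hv i hi
    exact hv fun h => hi (by simp [h])

lemma mem_coordinateSubspace {m : ℕ} {L : Finset (Fin m)} {v : Fin m → ZMod 2} :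
    v ∈ coordinateSubspace L ↔ ∀ i ∉ L, v i = 0 :=
  ⟨fun h _ hi => by_contra fun hv => hi (h hv), fun h i hi => by_contra fun hL => hi (h i hL)⟩

lemma simplicialComplex_univ {m : ℕ} :
    simplicialComplex (Finset.univ : Finset (Fin m)) = Set.univ := by
  simp [simplicialComplex]

lemma card_coordinateSubspace {m : ℕ} (L : Finset (Fin m)) :
    Nat.card (coordinateSubspace L) = 2 ^ L.card := by
  classical
  have e : coordinateSubspace L ≃ (L → ZMod 2) :=
    { toFun := fun v i => v.1 i
      invFun := fun w => ⟨fun i => if h : i ∈ L then w ⟨i, h⟩ else 0,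
        mem_coordinateSubspace.2 fun _ hi => dif_neg hi⟩
      left_inv := by
        rintro ⟨v, hv⟩
        ext i
        by_cases h : i ∈ L
        · simp [h]
        · simp [h, mem_coordinateSubspace.1 hv i h]
      right_inv := by
        intro w
        ext
        simp }
  rw [Nat.card_congr e]
  simp

lemma card_coordinateSubspace_prod {m : ℕ} (L M N : Finset (Fin m)) :
    Nat.card ((coordinateSubspace L).prod ((coordinateSubspace M).prod (coordinateSubspace N))) =
      2 ^ (L.card + M.card + N.card) := by
  have hprod : ∀ {E F : Type} [AddCommGroup E] [Module (ZMod 2) E] [AddCommGroup F]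
      [Module (ZMod 2) F] (U : Submodule (ZMod 2) E) (W : Submodule (ZMod 2) F),
      Nat.card (U.prod W) = Nat.card U * Nat.card W := by
    intro E F _ _ _ _ U W
    exact (Nat.card_congr (Equiv.Set.prod (U : Set E) (W : Set F))).trans (Nat.card_prod U W)
  rw [hprod, hprod, card_coordinateSubspace, card_coordinateSubspace, card_coordinateSubspace]
  ring

section Complexes

variable {m : ℕ} (L M N : Finset (Fin m))

lemma isPlanarFull_simplicialComplex : IsPlanarFull (simplicialComplex L) :=
  .submodule (coordinateSubspace L)

variable {L} in
lemma isPlanarFull_compl_simplicialComplex (h : L.card + 2 ≤ m) :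
    IsPlanarFull (simplicialComplex L)ᶜ := by
  refine .compl_submodule (coordinateSubspace L) ?_
  rw [card_coordinateSubspace, Nat.card_fun, Nat.card_zmod, Nat.card_fin]
  calc 4 * 2 ^ L.card = 2 ^ (L.card + 2) := by ring
    _ ≤ 2 ^ m := Nat.pow_le_pow_right two_pos h

variable {L M N}

lemma isPlanarFull_compl_simplicialComplex_prod (h : L.card + M.card + N.card + 2 ≤ 3 * m) :
    IsPlanarFull (simplicialComplex L ×ˢ simplicialComplex M ×ˢ simplicialComplex N)ᶜ := by
  refine .compl_submodule
    ((coordinateSubspace L).prod ((coordinateSubspace M).prod (coordinateSubspace N))) ?_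
  rw [card_coordinateSubspace_prod, Nat.card_prod, Nat.card_prod, Nat.card_fun, Nat.card_zmod,
    Nat.card_fin]
  calc 4 * 2 ^ (L.card + M.card + N.card) = 2 ^ (L.card + M.card + N.card + 2) := by ring
    _ ≤ 2 ^ (3 * m) := Nat.pow_le_pow_right two_pos h
    _ = 2 ^ m * (2 ^ m * 2 ^ m) := by ring

lemma isSelfOrthogonalSet_simplicialComplex (h : 3 ≤ L.card + M.card + N.card) :
    IsSelfOrthogonalSet (simplicialComplex L ×ˢ simplicialComplex M ×ˢ simplicialComplex N) := by
  refine .submodule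
    ((coordinateSubspace L).prod ((coordinateSubspace M).prod (coordinateSubspace N))) ?_
  rw [card_coordinateSubspace_prod]
  calc 4 < 2 ^ 3 := by norm_num
    _ ≤ 2 ^ (L.card + M.card + N.card) := Nat.pow_le_pow_right two_pos h

lemma IsSelfOrthogonalSet.compl_fst {T : Set ((Fin m → ZMod 2) × (Fin m → ZMod 2))}
    (h₁ : IsSelfOrthogonalSet (simplicialComplex (Finset.univ : Finset (Fin m)) ×ˢ T))
    (h₂ : IsSelfOrthogonalSet (simplicialComplex L ×ˢ T)) :
    IsSelfOrthogonalSet ((simplicialComplex L)ᶜ ×ˢ T) := by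
  rw [simplicialComplex_univ] at h₁
  convert h₁.diff h₂ (Set.prod_mono_left (Set.subset_univ _)) using 1
  ext ⟨x, y⟩
  simp
  tauto

lemma IsSelfOrthogonalSet.compl_snd {A B : Set (Fin m → ZMod 2)}
    (h₁ : IsSelfOrthogonalSet (A ×ˢ simplicialComplex (Finset.univ : Finset (Fin m)) ×ˢ B))
    (h₂ : IsSelfOrthogonalSet (A ×ˢ simplicialComplex L ×ˢ B)) :
    IsSelfOrthogonalSet (A ×ˢ (simplicialComplex L)ᶜ ×ˢ B) := by
  rw [simplicialComplex_univ] at h₁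
  convert h₁.diff h₂ (Set.prod_mono_right (Set.prod_mono_left (Set.subset_univ _))) using 1
  ext ⟨x, y, z⟩
  simp
  tauto

lemma IsSelfOrthogonalSet.compl_thd {A B : Set (Fin m → ZMod 2)}
    (h₁ : IsSelfOrthogonalSet (A ×ˢ B ×ˢ simplicialComplex (Finset.univ : Finset (Fin m))))
    (h₂ : IsSelfOrthogonalSet (A ×ˢ B ×ˢ simplicialComplex L)) :
    IsSelfOrthogonalSet (A ×ˢ B ×ˢ (simplicialComplex L)ᶜ) := by
  rw [simplicialComplex_univ] at h₁
  convert h₁.diff h₂ (Set.prod_mono_right (Set.prod_mono_right (Set.subset_univ _))) using 1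
  ext ⟨x, y, z⟩
  simp
  tauto

end Complexes

theorem mainTheorem2 (m : ℕ) (L M N : Finset (Fin m)) :
    (∀ (n : ℕ) (C : Submodule (ZMod 2) (Fin n → ZMod 2)),
      IsBinarySubfieldCodeOf
        (definingSet (simplicialComplex L) (simplicialComplex M) (simplicialComplex N)) C →
      IsMinimalCode C ∧
      (3 ≤ L.card + M.card + N.card → IsSelfOrthogonalCode C)) ∧
    (∀ (n : ℕ) (C : Submodule (ZMod 2) (Fin n → ZMod 2)),
      IsBinarySubfieldCodeOf
        (definingSet ((simplicialComplex L)ᶜ) (simplicialComplex M) (simplicialComplex N)) C →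
      (L.card + 2 ≤ m → IsMinimalCode C) ∧
      (3 ≤ M.card + N.card → IsSelfOrthogonalCode C)) ∧
    (∀ (n : ℕ) (C : Submodule (ZMod 2) (Fin n → ZMod 2)),
      IsBinarySubfieldCodeOf
        (definingSet (simplicialComplex L) ((simplicialComplex M)ᶜ) (simplicialComplex N)) C →
      (M.card + 2 ≤ m → IsMinimalCode C) ∧
      (3 ≤ L.card + N.card → IsSelfOrthogonalCode C)) ∧
    (∀ (n : ℕ) (C : Submodule (ZMod 2) (Fin n → ZMod 2)),
      IsBinarySubfieldCodeOf
        (definingSet (simplicialComplex L) (simplicialComplex M) ((simplicialComplex N)ᶜ)) C →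
      (N.card + 2 ≤ m → IsMinimalCode C) ∧
      (3 ≤ L.card + M.card → IsSelfOrthogonalCode C)) ∧
    (∀ (n : ℕ) (C : Submodule (ZMod 2) (Fin n → ZMod 2)),
      IsBinarySubfieldCodeOf
        (definingSet ((simplicialComplex L)ᶜ) ((simplicialComplex M)ᶜ) (simplicialComplex N)) C →
      (max L.card M.card + 2 ≤ m → IsMinimalCode C) ∧
      (3 ≤ N.card → IsSelfOrthogonalCode C)) ∧
    (∀ (n : ℕ) (C : Submodule (ZMod 2) (Fin n → ZMod 2)),
      IsBinarySubfieldCodeOf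
        (definingSet ((simplicialComplex L)ᶜ) (simplicialComplex M) ((simplicialComplex N)ᶜ)) C →
      (max L.card N.card + 2 ≤ m → IsMinimalCode C) ∧
      (3 ≤ M.card → IsSelfOrthogonalCode C)) ∧
    (∀ (n : ℕ) (C : Submodule (ZMod 2) (Fin n → ZMod 2)),
      IsBinarySubfieldCodeOf
        (definingSet (simplicialComplex L) ((simplicialComplex M)ᶜ) ((simplicialComplex N)ᶜ)) C →
      (max M.card N.card + 2 ≤ m → IsMinimalCode C) ∧
      (3 ≤ L.card → IsSelfOrthogonalCode C)) ∧
    (∀ (n : ℕ) (C : Submodule (ZMod 2) (Fin n → ZMod 2)),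
      IsBinarySubfieldCodeOf
        (definingSet ((simplicialComplex L)ᶜ) ((simplicialComplex M)ᶜ) ((simplicialComplex N)ᶜ)) C →
      (max (max L.card M.card) N.card + 2 ≤ m → IsMinimalCode C) ∧
      (L.Nonempty ∧ M.Nonempty ∧ N.Nonempty → IsSelfOrthogonalCode C)) ∧
    (∀ (n : ℕ) (C : Submodule (ZMod 2) (Fin n → ZMod 2)),
      IsBinarySubfieldCodeOf
        (definingSet (simplicialComplex L) (simplicialComplex M) (simplicialComplex N))ᶜ C →
      (L.card + M.card + N.card + 2 ≤ 3 * m → IsMinimalCode C) ∧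
      (3 ≤ L.card + M.card + N.card → IsSelfOrthogonalCode C)) := by
  have hL : L.card ≤ m := by simpa using L.card_le_univ
  have hM : M.card ≤ m := by simpa using M.card_le_univ
  have hN : N.card ≤ m := by simpa using N.card_le_univ
  have hcu : (Finset.univ : Finset (Fin m)).card = m := by simp
  refine ⟨?_, ?_, ?_, ?_, ?_, ?_, ?_, ?_, ?_⟩ <;> intro n C hC <;>
    rw [definingSet_eq_image] at hC
  · exact ⟨hC.isMinimalCode (.prod (isPlanarFull_simplicialComplex L)
      (.prod (isPlanarFull_simplicialComplex M) (isPlanarFull_simplicialComplex N))),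
      fun h => hC.isSelfOrthogonalCode (isSelfOrthogonalSet_simplicialComplex h)⟩
  -- By inclusion and exclusion, complements reduce self-orthogonality to products of complexes in
  -- which some factors are the whole space, the complex of the full index set of size `m`.
  · refine ⟨fun h => hC.isMinimalCode (.prod (isPlanarFull_compl_simplicialComplex (by omega))
      (.prod (isPlanarFull_simplicialComplex M) (isPlanarFull_simplicialComplex N))),
      fun h => hC.isSelfOrthogonalCode ?_⟩
    apply IsSelfOrthogonalSet.compl_fst <;>
      exact isSelfOrthogonalSet_simplicialComplex (by omega)
  · refine ⟨fun h => hC.isMinimalCode (.prod (isPlanarFull_simplicialComplex L)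
      (.prod (isPlanarFull_compl_simplicialComplex (by omega)) (isPlanarFull_simplicialComplex N))),
      fun h => hC.isSelfOrthogonalCode ?_⟩
    apply IsSelfOrthogonalSet.compl_snd <;>
      exact isSelfOrthogonalSet_simplicialComplex (by omega)
  · refine ⟨fun h => hC.isMinimalCode (.prod (isPlanarFull_simplicialComplex L)
      (.prod (isPlanarFull_simplicialComplex M) (isPlanarFull_compl_simplicialComplex (by omega)))),
      fun h => hC.isSelfOrthogonalCode ?_⟩
    apply IsSelfOrthogonalSet.compl_thd <;>
      exact isSelfOrthogonalSet_simplicialComplex (by omega)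
  · refine ⟨fun h => hC.isMinimalCode (.prod (isPlanarFull_compl_simplicialComplex (by omega))
      (.prod (isPlanarFull_compl_simplicialComplex (by omega)) (isPlanarFull_simplicialComplex N))),
      fun h => hC.isSelfOrthogonalCode ?_⟩
    apply IsSelfOrthogonalSet.compl_fst <;> apply IsSelfOrthogonalSet.compl_snd <;>
      exact isSelfOrthogonalSet_simplicialComplex (by omega)
  · refine ⟨fun h => hC.isMinimalCode (.prod (isPlanarFull_compl_simplicialComplex (by omega))
      (.prod (isPlanarFull_simplicialComplex M) (isPlanarFull_compl_simplicialComplex (by omega)))),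
      fun h => hC.isSelfOrthogonalCode ?_⟩
    apply IsSelfOrthogonalSet.compl_fst <;> apply IsSelfOrthogonalSet.compl_thd <;>
      exact isSelfOrthogonalSet_simplicialComplex (by omega)
  · refine ⟨fun h => hC.isMinimalCode (.prod (isPlanarFull_simplicialComplex L)
      (.prod (isPlanarFull_compl_simplicialComplex (by omega))
        (isPlanarFull_compl_simplicialComplex (by omega)))),
      fun h => hC.isSelfOrthogonalCode ?_⟩
    apply IsSelfOrthogonalSet.compl_snd <;>
      apply IsSelfOrthogonalSet.compl_thd <;>
      exact isSelfOrthogonalSet_simplicialComplex (by omega)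
  · refine ⟨fun h => hC.isMinimalCode (.prod (isPlanarFull_compl_simplicialComplex (by omega))
      (.prod (isPlanarFull_compl_simplicialComplex (by omega))
        (isPlanarFull_compl_simplicialComplex (by omega)))),
      fun h => hC.isSelfOrthogonalCode ?_⟩
    obtain ⟨h₁, h₂, h₃⟩ := h
    rw [← Finset.card_pos] at h₁ h₂ h₃
    apply IsSelfOrthogonalSet.compl_fst <;> apply IsSelfOrthogonalSet.compl_snd <;>
      apply IsSelfOrthogonalSet.compl_thd <;>
      exact isSelfOrthogonalSet_simplicialComplex (by omega)
  · rw [← Set.image_compl_eq (R2.combinationPi m).bijective] at hC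
    refine ⟨fun h => hC.isMinimalCode (isPlanarFull_compl_simplicialComplex_prod h),
      fun h => hC.isSelfOrthogonalCode ?_⟩
    rw [Set.compl_eq_univ_sdiff]
    refine .diff ?_ (isSelfOrthogonalSet_simplicialComplex h) (Set.subset_univ _)
    rw [← Set.univ_prod_univ, ← Set.univ_prod_univ, ← simplicialComplex_univ]
    exact isSelfOrthogonalSet_simplicialComplex (by omega)
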